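/- Let $K>10^6$ be an odd integer and let $N=K^6$. Let $\mathrm{Alt}(N)$ be the alternating group on the $N$ points of the six-dimensional cube $(\mathbb{Z}/K\mathbb{Z})^6$. For $i=1,\dots,6$ let $E_i\subset\mathrm{Alt}(N)$ be the image of $(\mathbb{Z}/K\mathbb{Z})^{K^5}$ acting on the cube so that each of its $K^5$ factors shifts cyclically the points of one of the $K^5$ lines parallel to the $i$-th coordinate axis (these permutations are even because $K$ is odd). Let $E=E_1\cup\dots\cup E_6$, and let $E^{47}$ be the set of all products of $47$ elements of $E$; since $1\in E=E^{-1}$, this is the ball of radius $47$ generated by $E$. Let $L$ be the largest integer of the form $1+a(K-1)$, with $a\ge 0$ an integer, that is less than $\frac{K^5}{3\ln K}$ (such an $L$ exists), and let $C_L$ be the set of all cycles of length $L$ in $\mathrm{Alt}(N)$. Then $C_L$ is a conjugacy class of $\mathrm{Alt}(N)$, and $$\left|C_L\setminus E^{47}\right|\le\frac{1}{100}\left|C_L\right| .$$ -/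

import Mathlib

open scoped Pointwise

/-- The `K ^ 6` points of the six-dimensional cube of size `K`. -/
abbrev Cube (K : ℕ) : Type := Fin 6 → ZMod K

/-- The product `(ℤ/Kℤ)^(K^5)`, one factor for each line in a fixed coordinate direction;
a line is labelled by its five constant coordinates. Written multiplicatively. -/
abbrev LineGroup (K : ℕ) : Type := Multiplicative ((Fin 5 → ZMod K) → ZMod K)

/-- The permutation of the cube that shifts cyclically every line parallel to the `i`-th axis,
the line labelled `ℓ` by the amount `γ ℓ`. -/
def lineShift {K : ℕ} (i : Fin 6) (γ : (Fin 5 → ZMod K) → ZMod K) : Equiv.Perm (Cube K) where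
  toFun x := Function.update x i (x i + γ (i.removeNth x))
  invFun x := Function.update x i (x i - γ (i.removeNth x))
  left_inv x := by simp
  right_inv x := by simp

/-- The `i`-th action of `(ℤ/Kℤ)^(K^5)` on the cube. -/
def lineShiftHom {K : ℕ} (i : Fin 6) : LineGroup K →* Equiv.Perm (Cube K) where
  toFun γ := lineShift i γ.toAdd
  map_one' := by
    ext x : 1
    simp [lineShift]
  map_mul' γ δ := by
    ext x : 1
    simp [lineShift, add_left_comm, add_comm]

theorem sign_lineShiftHom {K : ℕ} [NeZero K] (hK : Odd K) (i : Fin 6) (γ : LineGroup K) :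
    Equiv.Perm.sign (lineShiftHom i γ) = 1 := by
  have h : γ ^ K = 1 := by
    apply Multiplicative.toAdd.injective
    funext l
    simp
  have h2 : Equiv.Perm.sign (lineShiftHom i γ) ^ K = 1 := by
    rw [← map_pow, ← map_pow, h, map_one, map_one]
  rcases Int.units_eq_one_or (Equiv.Perm.sign (lineShiftHom i γ)) with h1 | h1
  · exact h1
  · rw [h1, hK.neg_one_pow] at h2
    exact absurd h2 (by decide)

/-- The `i`-th embedding `π_i` of `(ℤ/Kℤ)^(K^5)` in the alternating group on the points of the
cube, for odd `K`. -/
def lineEmbedding {K : ℕ} [NeZero K] (hK : Odd K) (i : Fin 6) :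
    LineGroup K →* alternatingGroup (Cube K) :=
  (lineShiftHom i).codRestrict (alternatingGroup (Cube K)) fun γ =>
    Equiv.Perm.mem_alternatingGroup.2 (sign_lineShiftHom hK i γ)

/-- The generating set `E`: the union of the images of the six embeddings. It contains `1`
and is closed under inverses, so its `n`-th power is the ball of radius `n`. -/
def lineShifts {K : ℕ} [NeZero K] (hK : Odd K) : Set (alternatingGroup (Cube K)) :=
  ⋃ i : Fin 6, Set.range (lineEmbedding hK i)

/-- The set of all cycles of length `L` in the alternating group on the points of the cube. -/
def cyclesOfLength (K : ℕ) [NeZero K] (L : ℕ) : Set (alternatingGroup (Cube K)) :=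
  {g | (g : Equiv.Perm (Cube K)).IsCycle ∧ (g : Equiv.Perm (Cube K)).support.card = L}

/-! Coordinates are numbered 0 to 5. The idea is to build one cycle `c` of length `L` from 7 line
shifts, with a well spread support inside the hyperplane `x 5 = 0`, and to show that for all but
1/100 of the permutations `g` some word `w` of 8 shifts agrees with `g` on the support of `c`. Then
`g * c * g⁻¹ = w * c * w⁻¹` is a product of 8 + 7 + 8 = 23 shifts, well within radius 47. As `g`
varies, the conjugate is uniformly distributed over the class, so few cycles of length `L` are
missed.

The cycle (`exists_cycle_spread`) grows by multiplying a cycle by cyclic shifts of lines that each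
meet its support in one point: every such line is absorbed and adds `K - 1` points. This explains
the form `1 + a * (K - 1)` of the lengths.

The word (`exists_word_eq_on`) uses axis 5 as a buffer: each point `a` receives a last coordinate `r
a`, then coordinates 0 to 4 are corrected one at a time, then the last one. A step succeeds if no
two points share a line in its direction, and `r` is chosen greedily to ensure this. For the last
step, the targets must have distinct projections along axis 5; an auxiliary shift along axis 4, also
chosen greedily, arranges this and is undone at the end.

The greedy choices need two load bounds: at most `⌊log K⌋₊` targets on each line along axis 4, and
fewer than `K / log K` points with given final coordinates before `s` and given initial coordinates
strictly between `s` and 5. The mean loads are below `1 / (3 log K)` and `5/14 * K / log K`, and a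
union bound with the tail `μ ^ k / k!` (`card_not_spread_le`) shows that random `g` rarely violates
them. -/

/-! ### Greedy choices -/

/-- Colours are assigned one vertex at a time. Since `h` allows an arbitrary colouring of the other
vertices, it applies to a partial colouring with arbitrary values elsewhere. -/
theorem exists_greedy_choice {V C : Type*} [DecidableEq V] [Nonempty C] (s : Finset V)
    (R : V → C → V → C → Prop) (hsymm : ∀ v c w d, R v c w d → R w d v c)
    (h : ∀ v ∈ s, ∀ γ : V → C, ∃ c, ∀ w ∈ s, w ≠ v → ¬ R v c w (γ w)) :
    ∃ γ : V → C, ∀ v ∈ s, ∀ w ∈ s, v ≠ w → ¬ R v (γ v) w (γ w) := by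
  suffices H : ∀ t ⊆ s, ∃ γ : V → C, ∀ v ∈ t, ∀ w ∈ t, v ≠ w → ¬ R v (γ v) w (γ w) from
    H s subset_rfl
  intro t
  induction t using Finset.induction_on with
  | empty => exact fun _ => ⟨fun _ => Classical.arbitrary C, by simp⟩
  | insert a t ha ih =>
    intro hts
    obtain ⟨γ, hγ⟩ := ih ((Finset.subset_insert a t).trans hts)
    obtain ⟨c, hc⟩ := h a (hts (Finset.mem_insert_self a t)) γ
    have hne : ∀ w ∈ t, w ≠ a := fun w hw e => ha (e ▸ hw)
    refine ⟨Function.update γ a c, fun v hv w hw hvw => ?_⟩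
    rcases Finset.mem_insert.1 hv with rfl | hv' <;> rcases Finset.mem_insert.1 hw with rfl | hw'
    · exact absurd rfl hvw
    · rw [Function.update_self, Function.update_of_ne (hne w hw')]
      exact hc w (hts (Finset.mem_insert_of_mem hw')) (hne w hw')
    · rw [Function.update_self, Function.update_of_ne (hne v hv')]
      exact fun hR => hc v (hts (Finset.mem_insert_of_mem hv')) (hne v hv') (hsymm _ _ _ _ hR)
    · rw [Function.update_of_ne (hne v hv'), Function.update_of_ne (hne w hw')]
      exact hγ v hv' w hw' hvw

/-! ### Counting in orbits -/

/-- By `hφ`, left translation permutes the fibres of `φ`, so all nonempty fibres have the size of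
the fibre through 1. This serves both for restricting permutations to a subset and for conjugation.
-/
theorem card_filter_map_mem_eq {G X : Type*} [Group G] [Fintype G] [DecidableEq X] (φ : G → X)
    (hφ : ∀ g h k : G, φ g = φ h → φ (k * g) = φ (k * h)) (S : Finset X)
    (hS : ∀ y ∈ S, ∃ g, φ g = y) :
    (Finset.univ.filter fun g => φ g ∈ S).card =
      S.card * (Finset.univ.filter fun g => φ g = φ 1).card := by
  rw [Finset.card_eq_sum_card_fiberwise (f := φ) (t := S) (fun g hg => by simpa using hg)]
  rw [← smul_eq_mul, ← Finset.sum_const]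
  refine Finset.sum_congr rfl fun y hy => ?_
  obtain ⟨k, rfl⟩ := hS y hy
  refine Finset.card_bij' (fun g _ => k⁻¹ * g) (fun g _ => k * g) ?_ ?_ ?_ ?_
  · intro g hg
    simp only [Finset.mem_filter, Finset.mem_univ, true_and] at hg ⊢
    simpa using hφ g k k⁻¹ hg.2
  · intro g hg
    simp only [Finset.mem_filter, Finset.mem_univ, true_and] at hg ⊢
    have := hφ g 1 k hg
    rw [mul_one] at this
    exact ⟨this ▸ hy, this⟩
  · intro g _; simp
  · intro g _; simp

theorem Nat.descFactorial_mul_pow_le {b n : ℕ} (h : b ≤ n) (k : ℕ) :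
    b.descFactorial k * n ^ k ≤ n.descFactorial k * b ^ k := by
  induction k with
  | zero => simp
  | succ k ih =>
    rw [Nat.descFactorial_succ, Nat.descFactorial_succ, pow_succ, pow_succ]
    have h2 : (b - k) * n ≤ (n - k) * b := by
      rw [Nat.sub_mul, Nat.sub_mul, mul_comm b n]
      exact Nat.sub_le_sub_left (Nat.mul_le_mul_left k h) _
    calc (b - k) * b.descFactorial k * (n ^ k * n)
        = (b - k) * n * (b.descFactorial k * n ^ k) := by ring
      _ ≤ (n - k) * b * (n.descFactorial k * b ^ k) := Nat.mul_le_mul h2 ih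
      _ = _ := by ring

section Perm

variable {α : Type*} [Fintype α] [DecidableEq α]

/-- The restriction of a uniform permutation to `J` is a uniform injection, and sampling without
replacement lands in `B` no more often than independent sampling would. -/
theorem card_perm_mapsTo_mul_le (J B : Finset α) :
    (Finset.univ.filter fun g : Equiv.Perm α => ∀ j ∈ J, g j ∈ B).card * Fintype.card α ^ J.card ≤
      B.card ^ J.card * Fintype.card (Equiv.Perm α) := by
  classical
  let φ : Equiv.Perm α → (J ↪ α) := fun g => ⟨fun j => g j, fun a b h => Subtype.ext (g.injective h)⟩
  have hφ : ∀ g h k : Equiv.Perm α, φ g = φ h → φ (k * g) = φ (k * h) := by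
    intro g h k e
    ext j
    have : g j = h j := DFunLike.congr_fun e j
    change k (g j) = k (h j)
    rw [this]
  have hsurj : ∀ f : J ↪ α, ∃ g, φ g = f := by
    intro f
    let e : {x // x ∈ J} ≃ {x // x ∈ Set.range f} := Equiv.ofInjective f f.injective
    refine ⟨e.extendSubtype, ?_⟩
    ext j
    exact Equiv.extendSubtype_apply_of_mem e j j.2
  have h1 := card_filter_map_mem_eq φ hφ (Finset.univ.filter fun f : J ↪ α => ∀ j, f j ∈ B)
    (fun y _ => hsurj y)
  have h2 := card_filter_map_mem_eq φ hφ Finset.univ (fun y _ => hsurj y)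
  simp only [Finset.mem_univ, Finset.filter_true, Finset.card_univ, Fintype.card_embedding_eq,
    Fintype.card_coe] at h2
  have h3 : (Finset.univ.filter fun f : J ↪ α => ∀ j, f j ∈ B).card ≤
      B.card.descFactorial J.card := by
    have : Fintype.card (J ↪ B) = B.card.descFactorial J.card := by
      simp [Fintype.card_embedding_eq]
    rw [← this, ← Fintype.card_coe]
    refine Fintype.card_le_of_injective
      (fun f => ⟨fun j => ⟨f.1 j, (Finset.mem_filter.1 f.2).2 j⟩, fun a b h => f.1.injective ?_⟩) ?_
    · simpa using h
    · intro f g h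
      ext j
      exact congrArg Subtype.val (DFunLike.congr_fun h j)
  have h4 : (Finset.univ.filter fun g : Equiv.Perm α => ∀ j ∈ J, g j ∈ B) =
      Finset.univ.filter fun g => φ g ∈ Finset.univ.filter fun f : J ↪ α => ∀ j, f j ∈ B := by
    ext g
    simp only [Finset.mem_filter, Finset.mem_univ, true_and]
    exact ⟨fun h j => h j j.2, fun h j hj => h ⟨j, hj⟩⟩
  rw [h4, h1, h2]
  set c := (Finset.univ.filter fun g => φ g = φ 1).card
  calc _ ≤ B.card.descFactorial J.card * c * Fintype.card α ^ J.card := by gcongr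
    _ = B.card.descFactorial J.card * Fintype.card α ^ J.card * c := by ring
    _ ≤ (Fintype.card α).descFactorial J.card * B.card ^ J.card * c :=
        Nat.mul_le_mul_right _ (Nat.descFactorial_mul_pow_le (Finset.card_le_univ B) _)
    _ = _ := by ring

/-- Union bound over the `k`-subsets of `J` that could be mapped into `B`; there are at most `|J| ^
k / k!` of them. -/
theorem card_perm_load_le [Nonempty α] (J B : Finset α) (k : ℕ) :
    ((Finset.univ.filter fun g : Equiv.Perm α => k ≤ (J.filter fun j => g j ∈ B).card).card : ℝ) ≤
      ((J.card : ℝ) * B.card / Fintype.card α) ^ k / k.factorial *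
        Fintype.card (Equiv.Perm α) := by
  have hN : (0 : ℝ) < Fintype.card α := by exact_mod_cast Fintype.card_pos
  have h1 : (Finset.univ.filter fun g : Equiv.Perm α => k ≤ (J.filter fun j => g j ∈ B).card) ⊆
      (J.powersetCard k).biUnion fun T =>
        Finset.univ.filter fun g : Equiv.Perm α => ∀ j ∈ T, g j ∈ B := by
    intro g hg
    obtain ⟨T, hT, hTk⟩ := Finset.exists_subset_card_eq (Finset.mem_filter.1 hg).2
    simp only [Finset.mem_biUnion, Finset.mem_filter, Finset.mem_univ, true_and,
      Finset.mem_powersetCard]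
    exact ⟨T, ⟨hT.trans (Finset.filter_subset _ _), hTk⟩,
      fun j hj => (Finset.mem_filter.1 (hT hj)).2⟩
  have h2 : ∀ T ∈ J.powersetCard k,
      ((Finset.univ.filter fun g : Equiv.Perm α => ∀ j ∈ T, g j ∈ B).card : ℝ) ≤
        ((B.card : ℝ) / Fintype.card α) ^ k * Fintype.card (Equiv.Perm α) := by
    intro T hT
    have := card_perm_mapsTo_mul_le T B
    rw [(Finset.mem_powersetCard.1 hT).2] at this
    rw [div_pow, div_mul_eq_mul_div, le_div_iff₀ (by positivity)]
    exact_mod_cast this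
  calc _ ≤ (((J.powersetCard k).biUnion fun T =>
        Finset.univ.filter fun g : Equiv.Perm α => ∀ j ∈ T, g j ∈ B).card : ℝ) := by
        exact_mod_cast Finset.card_le_card h1
    _ ≤ ∑ T ∈ J.powersetCard k,
        ((Finset.univ.filter fun g : Equiv.Perm α => ∀ j ∈ T, g j ∈ B).card : ℝ) := by
        exact_mod_cast Finset.card_biUnion_le
    _ ≤ ∑ T ∈ J.powersetCard k,
        ((B.card : ℝ) / Fintype.card α) ^ k * Fintype.card (Equiv.Perm α) :=
        Finset.sum_le_sum h2
    _ = (J.card.choose k : ℝ) *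
        (((B.card : ℝ) / Fintype.card α) ^ k * Fintype.card (Equiv.Perm α)) := by
        rw [Finset.sum_const, Finset.card_powersetCard, nsmul_eq_mul]
    _ ≤ ((J.card : ℝ) ^ k / k.factorial) *
        (((B.card : ℝ) / Fintype.card α) ^ k * Fintype.card (Equiv.Perm α)) := by
        gcongr
        exact Nat.choose_le_pow_div k J.card
    _ = _ := by
        rw [mul_div_assoc, mul_pow]
        ring

/-- A union bound over the events that too many elements of `J i` are mapped into `B i`. -/
theorem card_perm_exists_load_le [Nonempty α] {ι : Type*} (I : Finset ι) (J B : ι → Finset α)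
    (k : ℕ) (μ : ℝ)
    (h : ∀ i ∈ I, ((J i).card : ℝ) * (B i).card ≤ μ * Fintype.card α) :
    ((Finset.univ.filter fun g : Equiv.Perm α =>
      ∃ i ∈ I, k ≤ ((J i).filter fun j => g j ∈ B i).card).card : ℝ) ≤
      I.card * (μ ^ k / k.factorial) * Fintype.card (Equiv.Perm α) := by
  classical
  have hN : (0 : ℝ) < Fintype.card α := by exact_mod_cast Fintype.card_pos
  have h1 : (Finset.univ.filter fun g : Equiv.Perm α =>
      ∃ i ∈ I, k ≤ ((J i).filter fun j => g j ∈ B i).card) ⊆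
      I.biUnion fun i => Finset.univ.filter fun g : Equiv.Perm α =>
        k ≤ ((J i).filter fun j => g j ∈ B i).card := by
    intro g hg
    simpa using hg
  calc _ ≤ ((I.biUnion fun i => Finset.univ.filter fun g : Equiv.Perm α =>
        k ≤ ((J i).filter fun j => g j ∈ B i).card).card : ℝ) := by
        exact_mod_cast Finset.card_le_card h1
    _ ≤ ∑ i ∈ I, ((Finset.univ.filter fun g : Equiv.Perm α =>
        k ≤ ((J i).filter fun j => g j ∈ B i).card).card : ℝ) := by
        exact_mod_cast Finset.card_biUnion_le
    _ ≤ ∑ i ∈ I, μ ^ k / k.factorial * (Fintype.card (Equiv.Perm α) : ℝ) := by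
        refine Finset.sum_le_sum fun i hi => (card_perm_load_le (J i) (B i) k).trans ?_
        gcongr
        rw [div_le_iff₀ hN]
        exact h i hi
    _ = _ := by rw [Finset.sum_const, nsmul_eq_mul]; ring

/-- If few conjugators bring `c` into `S`, then `S` is a small part of the class of `c`. -/
theorem card_le_of_card_conj_le (c : Equiv.Perm α) (S C : Finset (Equiv.Perm α)) (hSC : S ⊆ C)
    (hC : ∀ y, y ∈ C ↔ IsConj c y) (δ : ℝ)
    (h : ((Finset.univ.filter fun g : Equiv.Perm α => g * c * g⁻¹ ∈ S).card : ℝ) ≤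
      δ * Fintype.card (Equiv.Perm α)) :
    (S.card : ℝ) ≤ δ * C.card := by
  let φ : Equiv.Perm α → Equiv.Perm α := fun g => g * c * g⁻¹
  have hφ : ∀ g h k : Equiv.Perm α, φ g = φ h → φ (k * g) = φ (k * h) := by
    intro g h k e
    have : ∀ g, φ (k * g) = k * φ g * k⁻¹ := fun g => by simp [φ, mul_assoc]
    rw [this, this, e]
  have hsurj : ∀ y ∈ C, ∃ g, φ g = y := fun y hy => isConj_iff.1 ((hC y).1 hy)
  have h1 := card_filter_map_mem_eq φ hφ S fun y hy => hsurj y (hSC hy)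
  have h2 := card_filter_map_mem_eq φ hφ C hsurj
  have h3 : (Finset.univ.filter fun g => φ g ∈ C) = Finset.univ :=
    Finset.filter_true_of_mem fun g _ => (hC _).2 (isConj_iff.2 ⟨g, rfl⟩)
  rw [h3, Finset.card_univ] at h2
  have h4 : 0 < (Finset.univ.filter fun g => φ g = φ 1).card :=
    Finset.card_pos.2 ⟨1, by simp⟩
  change ((Finset.univ.filter fun g => φ g ∈ S).card : ℝ) ≤ _ at h
  rw [h1, h2] at h
  push_cast at h
  rw [← mul_assoc] at h
  exact le_of_mul_le_mul_right h (by exact_mod_cast h4)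

end Perm

/-! ### Joining cycles -/

namespace Equiv.Perm

/-- If every nontrivial orbit of `τ` meets the cycle `S` of `σ` in exactly one point, then `σ * τ` is
a cycle on the union of `S` and these orbits. -/
theorem IsCycleOn.mul_of_sameCycle {α : Type*} [Finite α] {σ τ : Perm α} {S S' : Set α}
    (hσ : σ.IsCycleOn S) (hfix : ∀ x ∉ S, σ x = x)
    (hone : ∀ s ∈ S, ∀ t ∈ S, τ.SameCycle s t → s = t)
    (hS' : ∀ x, x ∈ S' ↔ ∃ s ∈ S, τ.SameCycle s x) :
    (σ * τ).IsCycleOn S' := by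
  have hSS' : ∀ x ∈ S, x ∈ S' := fun x hx => (hS' x).2 ⟨x, hx, SameCycle.rfl⟩
  have hσm : ∀ x, σ x ∈ S ↔ x ∈ S := fun x => hσ.apply_mem_iff
  have hmem : ∀ x, (σ * τ) x ∈ S' ↔ x ∈ S' := by
    intro x
    have h1 : ∀ y, σ y ∈ S' ↔ y ∈ S' := by
      intro y
      by_cases hy : y ∈ S
      · exact ⟨fun _ => hSS' y hy, fun _ => hSS' _ ((hσm y).2 hy)⟩
      · rw [hfix y hy]
    rw [mul_apply, h1, hS', hS']
    simp
  -- Outside `S` the product acts as `τ`, so it follows the `τ`-orbit of `s` until that orbit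
  -- re-enters `S`, which by `hone` can happen only at `s` itself.
  have hpow : ∀ s ∈ S, ∀ n : ℕ, (σ * τ).SameCycle s ((τ ^ n) s) := by
    intro s hs n
    induction n with
    | zero => simp [SameCycle.rfl]
    | succ n ih =>
      by_cases h : (τ ^ (n + 1)) s ∈ S
      · rw [← hone s hs _ h ⟨(n + 1 : ℕ), by rw [zpow_natCast]⟩]
      · have h2 : (σ * τ) ((τ ^ n) s) = (τ ^ (n + 1)) s := by
          rw [mul_apply, ← mul_apply τ, ← pow_succ', hfix _ h]
        rw [← h2]
        exact sameCycle_apply_right.2 ih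
  have horb : ∀ s ∈ S, ∀ x, τ.SameCycle s x → (σ * τ).SameCycle s x := by
    intro s hs x hx
    obtain ⟨n, rfl⟩ := hx.exists_nat_pow_eq
    exact hpow s hs n
  -- From the last point `τ⁻¹ s` of the orbit, the product jumps to `σ s`, where the next orbit
  -- begins.
  have hstep : ∀ s ∈ S, (σ * τ).SameCycle s (σ s) := by
    intro s hs
    have h1 := horb s hs (τ⁻¹ s) ⟨-1, by rw [zpow_neg_one]⟩
    have h2 : (σ * τ) (τ⁻¹ s) = σ s := by simp
    rw [← h2]
    exact sameCycle_apply_right.2 h1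
  have hS : ∀ s ∈ S, ∀ t ∈ S, (σ * τ).SameCycle s t := by
    intro s hs t ht
    obtain ⟨n, rfl⟩ := (hσ.2 hs ht).exists_nat_pow_eq
    have key : ∀ n : ℕ, (σ ^ n) s ∈ S ∧ (σ * τ).SameCycle s ((σ ^ n) s) := by
      intro n
      induction n with
      | zero => exact ⟨hs, SameCycle.rfl⟩
      | succ n ih =>
        rw [pow_succ', mul_apply]
        exact ⟨(hσm _).2 ih.1, ih.2.trans (hstep _ ih.1)⟩
    exact (key n).2
  refine ⟨⟨fun x hx => (hmem x).2 hx, (σ * τ).injective.injOn, fun y hy =>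
    ⟨(σ * τ)⁻¹ y, (hmem _).1 (by simpa using hy), by simp⟩⟩, fun x hx y hy => ?_⟩
  obtain ⟨s, hs, hsx⟩ := (hS' x).1 hx
  obtain ⟨t, ht, hty⟩ := (hS' y).1 hy
  exact (horb s hs x hsx).symm.trans ((hS s hs t ht).trans (horb t ht y hty))

end Equiv.Perm

/-! ### Line shifts as permutations -/

/-- The line shifts in all six directions, as permutations of the cube. -/
def shiftPerms (K : ℕ) : Set (Equiv.Perm (Cube K)) := {e | ∃ i γ, e = lineShift i γ}

section Shifts

variable {K : ℕ}

theorem lineShift_apply (i : Fin 6) (γ : (Fin 5 → ZMod K) → ZMod K) (x : Cube K) :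
    lineShift i γ x = Function.update x i (x i + γ (i.removeNth x)) := rfl

theorem removeNth_eq_iff (i : Fin 6) (x y : Cube K) :
    i.removeNth x = i.removeNth y ↔ ∀ j, j ≠ i → x j = y j := by
  constructor
  · intro h j hj
    obtain ⟨k, rfl⟩ := Fin.exists_succAbove_eq hj
    exact congrFun h k
  · intro h
    funext k
    exact h _ (Fin.succAbove_ne i k)

theorem one_mem_shiftPerms : (1 : Equiv.Perm (Cube K)) ∈ shiftPerms K :=
  ⟨0, 0, by ext x : 1; simp [lineShift_apply]⟩

theorem inv_mem_shiftPerms {e : Equiv.Perm (Cube K)} (he : e ∈ shiftPerms K) :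
    e⁻¹ ∈ shiftPerms K := by
  obtain ⟨i, γ, rfl⟩ := he
  refine ⟨i, -γ, ?_⟩
  rw [inv_eq_iff_mul_eq_one]
  ext x : 1
  simp [lineShift_apply]

theorem inv_shiftPerms : (shiftPerms K)⁻¹ = shiftPerms K := by
  ext e
  rw [Set.mem_inv]
  exact ⟨fun h => by simpa using inv_mem_shiftPerms h, inv_mem_shiftPerms⟩

theorem inv_mem_shiftPerms_pow {e : Equiv.Perm (Cube K)} {n : ℕ} (he : e ∈ shiftPerms K ^ n) :
    e⁻¹ ∈ shiftPerms K ^ n := by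
  have h : e⁻¹ ∈ (shiftPerms K ^ n)⁻¹ := by simpa using he
  rwa [← inv_pow, inv_shiftPerms] at h

theorem lineShift_mem (i : Fin 6) (γ : (Fin 5 → ZMod K) → ZMod K) :
    lineShift i γ ∈ shiftPerms K := ⟨i, γ, rfl⟩

theorem image_lineShifts_pow [NeZero K] (hK : Odd K) (n : ℕ) :
    (alternatingGroup (Cube K)).subtype '' (lineShifts hK ^ n) = shiftPerms K ^ n := by
  rw [Set.image_pow]
  congr 1
  ext e
  constructor
  · rintro ⟨g, hg, rfl⟩
    obtain ⟨i, γ, rfl⟩ := Set.mem_iUnion.1 hg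
    exact ⟨i, γ.toAdd, rfl⟩
  · rintro ⟨i, γ, rfl⟩
    exact ⟨lineEmbedding hK i (Multiplicative.ofAdd γ),
      Set.mem_iUnion.2 ⟨i, Set.mem_range_self _⟩, rfl⟩

theorem mem_lineShifts_pow_iff [NeZero K] (hK : Odd K) (n : ℕ) (g : alternatingGroup (Cube K)) :
    g ∈ lineShifts hK ^ n ↔ (g : Equiv.Perm (Cube K)) ∈ shiftPerms K ^ n := by
  rw [← image_lineShifts_pow hK]
  constructor
  · exact fun h => ⟨g, h, rfl⟩
  · rintro ⟨g', h, he⟩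
    rwa [← Subtype.ext he]

/-! ### Moving a finite set of points -/

/-- The points `P a` lie on distinct lines in direction `i`, so each line can be given the amount
its own point needs. -/
theorem exists_shift_eq (A : Finset (Cube K)) (P Q : Cube K → Cube K) (i : Fin 6)
    (hPQ : ∀ a ∈ A, ∀ j, j ≠ i → Q a j = P a j)
    (hinj : ∀ a ∈ A, ∀ b ∈ A, (∀ j, j ≠ i → P a j = P b j) → a = b) :
    ∃ e ∈ shiftPerms K, ∀ a ∈ A, e (P a) = Q a := by
  classical
  let γ : (Fin 5 → ZMod K) → ZMod K := fun l =>
    if h : ∃ a ∈ A, i.removeNth (P a) = l then Q h.choose i - P h.choose i else 0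
  refine ⟨lineShift i γ, lineShift_mem i γ, fun a ha => ?_⟩
  have h : ∃ b ∈ A, i.removeNth (P b) = i.removeNth (P a) := ⟨a, ha, rfl⟩
  have hb : h.choose = a :=
    hinj _ h.choose_spec.1 a ha ((removeNth_eq_iff i _ _).1 h.choose_spec.2)
  have hγ : γ (i.removeNth (P a)) = Q a i - P a i := by
    simp only [γ]
    rw [dif_pos h, hb]
  rw [lineShift_apply, hγ, add_sub_cancel]
  funext j
  by_cases hj : j = i
  · subst hj; simp
  · rw [Function.update_of_ne hj, hPQ a ha j hj]

/-- Points in general position with respect to the last axis can be moved to other such points,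
through a suitable intermediate choice `r` of their last coordinates. -/
theorem exists_route (A : Finset (Cube K)) (q : Cube K → Cube K)
    (hA : ∀ a ∈ A, ∀ b ∈ A, (∀ j, j ≠ 5 → a j = b j) → a = b)
    (hq : ∀ a ∈ A, ∀ b ∈ A, (∀ j, j ≠ 5 → q a j = q b j) → a = b)
    (r : Cube K → ZMod K)
    (hr : ∀ a ∈ A, ∀ b ∈ A, a ≠ b → ∀ s : Fin 6, s < 5 → (∀ j, j < s → q a j = q b j) →
      (∀ j, s < j → j < 5 → a j = b j) → r a ≠ r b) :
    ∃ w ∈ shiftPerms K ^ 7, ∀ a ∈ A, w a = q a := by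
  -- Position of `a` after `s` corrections: target coordinates below `s`, original ones from `s` to
  -- 4, and the buffer value `r a` in coordinate 5. Two points sharing a line in direction `s` at
  -- this stage are exactly the conflicts excluded by `hr`.
  let H : ℕ → Cube K → Cube K := fun s a j =>
    if j = 5 then r a else if j.val < s then q a j else a j
  have key : ∀ s ≤ 5, ∃ w ∈ shiftPerms K ^ (s + 1), ∀ a ∈ A, w a = H s a := by
    intro s
    induction s with
    | zero =>
      intro _
      obtain ⟨e, he, h⟩ := exists_shift_eq A id (H 0) 5 (fun a _ j hj => by simp [H, hj]) hA
      exact ⟨e, by simpa using he, h⟩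
    | succ s ih =>
      intro hs
      obtain ⟨w, hw, hwA⟩ := ih (by omega)
      have hs5 : (⟨s, by omega⟩ : Fin 6) < 5 := by
        rw [Fin.lt_def]
        exact hs
      have hkeep : ∀ a ∈ A, ∀ j, j ≠ ⟨s, by omega⟩ → H (s + 1) a j = H s a j := by
        intro a _ j hj
        have hj' : j.val ≠ s := fun e => hj (Fin.ext e)
        have : j.val < s + 1 ↔ j.val < s := by omega
        simp only [H, this]
      have hinj : ∀ a ∈ A, ∀ b ∈ A, (∀ j, j ≠ ⟨s, by omega⟩ → H s a j = H s b j) → a = b := by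
        intro a ha b hb hab
        by_contra hne
        refine hr a ha b hb hne ⟨s, by omega⟩ hs5 ?_ ?_ ?_
        · intro j hj
          have h1 := hab j hj.ne
          have h2 : j ≠ 5 := (hj.trans hs5).ne
          have h3 : j.val < s := hj
          simpa [H, h2, h3] using h1
        · intro j hj hj5
          have h1 := hab j hj.ne'
          have h3 : ¬ j.val < s := not_lt.2 (le_of_lt (show s < j.val from hj))
          simpa [H, hj5.ne, h3] using h1
        · simpa [H] using hab 5 hs5.ne'
      obtain ⟨e, he, h⟩ := exists_shift_eq A (H s) (H (s + 1)) ⟨s, by omega⟩ hkeep hinj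
      refine ⟨e * w, ?_, fun a ha => by rw [Equiv.Perm.mul_apply, hwA a ha, h a ha]⟩
      rw [pow_succ' _ (s + 1)]
      exact Set.mul_mem_mul he hw
  obtain ⟨w, hw, hwA⟩ := key 5 le_rfl
  have hH : ∀ a, ∀ j, j ≠ 5 → H 5 a j = q a j := by
    intro a j hj
    have h3 : j.val < 5 := by
      have := j.isLt
      have h5 : j.val ≠ 5 := fun e => hj (Fin.ext e)
      omega
    simp [H, hj, h3]
  obtain ⟨e, he, h⟩ := exists_shift_eq A (H 5) q 5 (fun a _ j hj => (hH a j hj).symm) (by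
    intro a ha b hb hab
    refine hq a ha b hb fun j hj => ?_
    rw [← hH a j hj, ← hH b j hj]
    exact hab j hj)
  refine ⟨e * w, ?_, fun a ha => by rw [Equiv.Perm.mul_apply, hwA a ha, h a ha]⟩
  rw [pow_succ' _ 6]
  exact Set.mul_mem_mul he hw

/-! ### Attaching lines to a cycle -/

theorem lineShift_zpow (i : Fin 6) (γ : (Fin 5 → ZMod K) → ZMod K) (n : ℤ) :
    lineShift i γ ^ n = lineShift i (n • γ) := by
  change lineShiftHom i (Multiplicative.ofAdd γ) ^ n = lineShiftHom i (Multiplicative.ofAdd (n • γ))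
  rw [← map_zpow, ofAdd_zsmul]

theorem sameCycle_lineShift_iff (i : Fin 6) (γ : (Fin 5 → ZMod K) → ZMod K) (x y : Cube K) :
    (lineShift i γ).SameCycle x y ↔
      ∃ n : ℤ, Function.update x i (x i + n * γ (i.removeNth x)) = y := by
  refine exists_congr fun n => ?_
  rw [lineShift_zpow, lineShift_apply]
  simp

/-- The union of `S` and of the lines in direction `i` through the points of `T`. -/
def attachLines [NeZero K] (S T : Finset (Cube K)) (i : Fin 6) : Finset (Cube K) :=
  S ∪ T.biUnion fun t => (Finset.univ.erase (t i)).image (Function.update t i)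

theorem mem_attachLines [NeZero K] {S T : Finset (Cube K)} (hTS : T ⊆ S) {i : Fin 6}
    {x : Cube K} :
    x ∈ attachLines S T i ↔ x ∈ S ∨ ∃ t ∈ T, ∃ c, x = Function.update t i c := by
  simp only [attachLines, Finset.mem_union, Finset.mem_biUnion, Finset.mem_image, Finset.mem_erase,
    Finset.mem_univ, and_true]
  constructor
  · rintro (h | ⟨t, ht, c, -, rfl⟩)
    · exact Or.inl h
    · exact Or.inr ⟨t, ht, c, rfl⟩
  · rintro (h | ⟨t, ht, c, rfl⟩)
    · exact Or.inl h
    · by_cases hc : c = t i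
      · left
        rw [hc, Function.update_eq_self]
        exact hTS ht
      · exact Or.inr ⟨t, ht, c, hc, rfl⟩

theorem card_attachLines [NeZero K] {S T : Finset (Cube K)} (hTS : T ⊆ S) {i : Fin 6}
    (h : ∀ t ∈ T, ∀ s ∈ S, (∀ j, j ≠ i → s j = t j) → s = t) :
    (attachLines S T i).card = S.card + T.card * (K - 1) := by
  rw [attachLines, Finset.card_union_of_disjoint, Finset.card_biUnion]
  · congr 1
    rw [Finset.sum_const_nat]
    intro t _
    rw [Finset.card_image_of_injective _ (Function.update_injective t i),
      Finset.card_erase_of_mem (Finset.mem_univ _), Finset.card_univ, ZMod.card]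
  · intro t ht t' ht' hne
    rw [Function.onFun, Finset.disjoint_left]
    rintro x hx hx'
    obtain ⟨c, -, rfl⟩ := Finset.mem_image.1 hx
    obtain ⟨c', -, he⟩ := Finset.mem_image.1 hx'
    refine hne (h t' ht' t (hTS ht) fun j hj => ?_)
    have := congrFun he j
    rw [Function.update_of_ne hj, Function.update_of_ne hj] at this
    exact this.symm
  · rw [Finset.disjoint_left]
    intro x hx hx'
    obtain ⟨t, ht, hx'⟩ := Finset.mem_biUnion.1 hx'
    obtain ⟨c, hc, rfl⟩ := Finset.mem_image.1 hx'
    have := congrFun (h t ht _ hx fun j hj => Function.update_of_ne hj _ _) i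
    rw [Function.update_self] at this
    exact Finset.ne_of_mem_erase hc this

/-- Shifting each line through `T` by 1 is a product of `K`-cycles, each meeting `S` in a single
point by `h`; `IsCycleOn.mul_of_sameCycle` splices them into the cycle at the cost of one shift. -/
theorem exists_isCycleOn_attachLines [NeZero K] {S T : Finset (Cube K)} (hTS : T ⊆ S) {i : Fin 6}
    (h : ∀ t ∈ T, ∀ s ∈ S, (∀ j, j ≠ i → s j = t j) → s = t) {n : ℕ}
    {σ : Equiv.Perm (Cube K)} (hn : σ ∈ shiftPerms K ^ n) (hσ : σ.IsCycleOn (S : Set (Cube K)))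
    (hfix : ∀ x ∉ S, σ x = x) :
    ∃ τ ∈ shiftPerms K ^ (n + 1), τ.IsCycleOn (attachLines S T i : Set (Cube K)) ∧
      ∀ x ∉ attachLines S T i, τ x = x := by
  classical
  let γ : (Fin 5 → ZMod K) → ZMod K := fun l => if ∃ t ∈ T, i.removeNth t = l then 1 else 0
  have hγ1 : ∀ t ∈ T, γ (i.removeNth t) = 1 := fun t ht => if_pos ⟨t, ht, rfl⟩
  have hγ0 : ∀ s ∈ S, s ∉ T → γ (i.removeNth s) = 0 := by
    intro s hs hsT
    refine if_neg ?_
    rintro ⟨t, ht, he⟩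
    exact hsT (h t ht s hs ((removeNth_eq_iff i _ _).1 he.symm) ▸ ht)
  refine ⟨σ * lineShift i γ, ?_, ?_, ?_⟩
  · rw [pow_succ]
    exact Set.mul_mem_mul hn (lineShift_mem i γ)
  · refine hσ.mul_of_sameCycle (fun x hx => hfix x (by simpa using hx)) ?_ ?_
    · intro s hs t ht hst
      obtain ⟨m, rfl⟩ := (sameCycle_lineShift_iff i γ s t).1 hst
      by_cases hsT : s ∈ T
      · exact (h s hsT _ ht fun j hj => Function.update_of_ne hj _ _).symm
      · simp [hγ0 s hs hsT]
    · intro x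
      rw [Finset.mem_coe, mem_attachLines hTS]
      constructor
      · rintro (hx | ⟨t, ht, c, rfl⟩)
        · exact ⟨x, hx, Equiv.Perm.SameCycle.rfl⟩
        · refine ⟨t, hTS ht, (sameCycle_lineShift_iff i γ _ _).2 ⟨((c - t i).val : ℤ), ?_⟩⟩
          rw [hγ1 t ht]
          simp
      · rintro ⟨s, hs, hsx⟩
        obtain ⟨m, rfl⟩ := (sameCycle_lineShift_iff i γ _ _).1 hsx
        by_cases hsT : s ∈ T
        · exact Or.inr ⟨s, hsT, _, rfl⟩
        · left
          rw [hγ0 s hs hsT]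
          simpa using hs
  · intro x hx
    rw [mem_attachLines hTS, not_or] at hx
    have h0 : γ (i.removeNth x) = 0 := by
      refine if_neg ?_
      rintro ⟨t, ht, he⟩
      refine hx.2 ⟨t, ht, x i, ?_⟩
      funext j
      by_cases hj : j = i
      · subst hj; simp
      · rw [Function.update_of_ne hj]
        exact ((removeNth_eq_iff i _ _).1 he j hj).symm
    rw [Equiv.Perm.mul_apply, lineShift_apply, h0, add_zero, Function.update_eq_self, hfix x hx.1]

end Shifts

/-! ### A cycle with well spread support -/

section Cycle

variable {K : ℕ} [NeZero K]

/-- The points whose first coordinate is in `I` and whose coordinates from the `i`-th on vanish. -/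
def slab (I : Finset (ZMod K)) (i : ℕ) : Finset (Cube K) :=
  Fintype.piFinset fun j => if j = 0 then I else if j.val < i then Finset.univ else {0}

theorem mem_slab {I : Finset (ZMod K)} {i : ℕ} {x : Cube K} :
    x ∈ slab I i ↔ x 0 ∈ I ∧ ∀ j : Fin 6, j ≠ 0 → i ≤ j.val → x j = 0 := by
  simp only [slab, Fintype.mem_piFinset]
  constructor
  · intro h
    refine ⟨by simpa using h 0, fun j hj hij => ?_⟩
    simpa [hj, not_lt.2 hij] using h j
  · rintro ⟨h0, h⟩ j
    by_cases hj : j = 0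
    · subst hj; simpa using h0
    · by_cases hij : j.val < i
      · simp [hj, hij]
      · simpa [hj, hij] using h j hj (not_lt.1 hij)

theorem card_slab (I : Finset (ZMod K)) (i : ℕ) (h1 : 1 ≤ i) (h4 : i ≤ 4) :
    (slab I i).card = I.card * K ^ (i - 1) := by
  rw [slab, Fintype.card_piFinset]
  rw [Fin.prod_univ_six]
  interval_cases i <;> simp <;> ring

/-- `S` is the support of a cycle that is a product of `n` line shifts, has `1 + a * (K - 1)`
elements, and apart from the first axis lies in the hyperplanes over `I`. -/
def IsStage (I : Finset (ZMod K)) (i n a : ℕ) (S : Finset (Cube K)) : Prop :=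
  (∃ σ ∈ shiftPerms K ^ n, σ.IsCycleOn (S : Set (Cube K)) ∧ ∀ x ∉ S, σ x = x) ∧
    S.card = 1 + a * (K - 1) ∧ (∀ x ∈ S, ∀ j : Fin 6, i ≤ j.val → x j = 0) ∧
    ∀ x ∈ S, x 0 ∈ I ∨ ∀ j : Fin 6, j ≠ 0 → x j = 0

theorem exists_isStage_one (I : Finset (ZMod K)) :
    ∃ S, IsStage I 1 1 1 S ∧ slab I 1 ⊆ S := by
  have h0 : ∀ t ∈ ({0} : Finset (Cube K)), ∀ s ∈ ({0} : Finset (Cube K)),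
      (∀ j, j ≠ 0 → s j = t j) → s = t := by
    intro t ht s hs _
    rw [Finset.mem_singleton.1 ht, Finset.mem_singleton.1 hs]
  have hmem : ∀ x : Cube K, x ∈ attachLines {0} {0} 0 ↔ ∀ j : Fin 6, j ≠ 0 → x j = 0 := by
    intro x
    rw [mem_attachLines subset_rfl]
    constructor
    · rintro (hx | ⟨t, ht, c, rfl⟩) j hj
      · rw [Finset.mem_singleton.1 hx]; rfl
      · rw [Finset.mem_singleton.1 ht, Function.update_of_ne hj]; rfl
    · intro h
      refine Or.inr ⟨0, Finset.mem_singleton_self _, x 0, ?_⟩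
      funext j
      by_cases hj : j = 0
      · subst hj; simp
      · rw [Function.update_of_ne hj, h j hj]; rfl
  refine ⟨attachLines {0} {0} 0, ⟨?_, ?_, ?_, ?_⟩, ?_⟩
  · exact exists_isCycleOn_attachLines (n := 0) subset_rfl h0 (σ := 1) (by simp) (by simp)
      (by simp)
  · rw [card_attachLines subset_rfl h0]
    simp
  · intro x hx j hj
    exact (hmem x).1 hx j (by rintro rfl; simp at hj)
  · exact fun x hx => Or.inr ((hmem x).1 hx)
  · intro x hx
    refine (hmem x).2 fun j hj => (mem_slab.1 hx).2 j hj ?_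
    have : j.val ≠ 0 := fun e => hj (Fin.ext e)
    omega

/-- All points of `S` vanish in coordinate `i`, so a line in direction `i` meets `S` at most once
and attaching is possible. -/
theorem IsStage.attach {I : Finset (ZMod K)} {n a : ℕ} {S T : Finset (Cube K)} {i : Fin 6}
    (hi : i ≠ 0) (h : IsStage I i n a S) (hTS : T ⊆ S) (hT : T ⊆ slab I i) :
    IsStage I (i + 1) (n + 1) (a + T.card) (attachLines S T i) := by
  obtain ⟨⟨σ, hn, hσ, hfix⟩, hcard, hz, hI⟩ := h
  have hline : ∀ t ∈ T, ∀ s ∈ S, (∀ j, j ≠ i → s j = t j) → s = t := by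
    intro t ht s hs hst
    funext j
    by_cases hj : j = i
    · subst hj
      rw [hz s hs j le_rfl, hz t (hTS ht) j le_rfl]
    · exact hst j hj
  refine ⟨exists_isCycleOn_attachLines hTS hline hn hσ hfix, ?_, ?_, ?_⟩
  · rw [card_attachLines hTS hline, hcard]
    ring
  · intro x hx j hj
    rcases (mem_attachLines hTS).1 hx with hx | ⟨t, ht, c, rfl⟩
    · exact hz x hx j (by omega)
    · rw [Function.update_of_ne (by rintro rfl; omega)]
      exact hz t (hTS ht) j (by omega)
  · intro x hx
    rcases (mem_attachLines hTS).1 hx with hx | ⟨t, ht, c, rfl⟩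
    · exact hI x hx
    · left
      rw [Function.update_of_ne hi.symm]
      exact (mem_slab.1 (hT ht)).1

theorem slab_subset_attachLines {I : Finset (ZMod K)} {S : Finset (Cube K)} {i : Fin 6}
    (hi : i ≠ 0) (hS : slab I i ⊆ S) : slab I (i + 1) ⊆ attachLines S (slab I i) i := by
  intro x hx
  rw [mem_slab] at hx
  refine (mem_attachLines hS).2 (Or.inr ⟨Function.update x i 0, ?_, x i, by simp⟩)
  rw [mem_slab, Function.update_of_ne hi.symm]
  refine ⟨hx.1, fun j hj hij => ?_⟩
  by_cases h : j = i
  · subst h; simp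
  · rw [Function.update_of_ne h]
    have : j.val ≠ i.val := fun e => h (Fin.ext e)
    exact hx.2 j hj (by omega)

/-- The axis-0 line counts 1; the full slabs then attach `|I|`, `|I| * K` and `|I| * K ^ 2` lines in
directions 1, 2 and 3. The last direction uses only `b` points of its slab, which tunes the length.
-/
theorem exists_isStage_five (I : Finset (ZMod K)) (b : ℕ) (hb : b ≤ I.card * K ^ 3) :
    ∃ S, IsStage I 5 5 (1 + I.card * (1 + K + K ^ 2) + b) S := by
  obtain ⟨S₁, h₁, hs₁⟩ := exists_isStage_one I
  have h₂ := h₁.attach (i := 1) (by decide) hs₁ subset_rfl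
  have hs₂ := slab_subset_attachLines (i := 1) (by decide) hs₁
  have h₃ := IsStage.attach (i := 2) (by decide) h₂ hs₂ subset_rfl
  have hs₃ := slab_subset_attachLines (i := 2) (by decide) hs₂
  have h₄ := IsStage.attach (i := 3) (by decide) h₃ hs₃ subset_rfl
  have hs₄ := slab_subset_attachLines (i := 3) (by decide) hs₃
  have hb4 : b ≤ (slab I 4).card := by rwa [card_slab I 4 (by norm_num) le_rfl]
  obtain ⟨T, hT, hTb⟩ := Finset.exists_subset_card_eq hb4
  have h₅ := IsStage.attach (i := 4) (by decide) h₄ (hT.trans hs₄) hT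
  rw [hTb] at h₅
  have e1 : (slab I 1).card = I.card := by
    rw [card_slab I 1 le_rfl (by norm_num)]; simp
  have e2 : (slab I 2).card = I.card * K := by
    rw [card_slab I 2 (by norm_num) (by norm_num)]; simp
  have e3 : (slab I 3).card = I.card * K ^ 2 := card_slab I 3 (by norm_num) (by norm_num)
  have e : 1 + I.card * (1 + K + K ^ 2) + b =
      1 + (slab I 1).card + (slab I 2).card + (slab I 3).card + b := by
    rw [e1, e2, e3]; ring
  rw [e]
  exact ⟨_, h₅⟩

/-- There is a cycle in a small ball, of any length `1 + a * (K - 1)` in a certain range, whose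
support lies in a coordinate hyperplane and has few points on each line along the first axis. -/
theorem exists_cycle_spread (n a : ℕ) (hnK : n ≤ K) (h2K : 2 ≤ K)
    (ha1 : 1 + n * (1 + K + K ^ 2) ≤ a) (ha2 : a ≤ 1 + n * (1 + K + K ^ 2 + K ^ 3)) :
    ∃ c ∈ shiftPerms K ^ 7, c.IsCycle ∧ c.support.card = 1 + a * (K - 1) ∧
      (∀ x ∈ c.support, x 5 = 0) ∧
      ∀ β : Cube K, (c.support.filter fun x => ∀ j, 0 < j → j < 5 → x j = β j).card ≤ n + 1 := by
  classical
  obtain ⟨I, -, hI⟩ := Finset.exists_subset_card_eq (s := (Finset.univ : Finset (ZMod K)))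
    (n := n) (by rwa [Finset.card_univ, ZMod.card])
  obtain ⟨b, rfl⟩ := Nat.exists_eq_add_of_le ha1
  have hb : b ≤ I.card * K ^ 3 := by
    rw [hI]
    linarith
  obtain ⟨S, ⟨σ, hσ5, hσ, hfix⟩, hcard, hz, hSI⟩ := exists_isStage_five I b hb
  rw [hI] at hcard
  have hS2 : 1 < S.card := by
    rw [hcard]
    have : 0 < (1 + n * (1 + K + K ^ 2) + b) * (K - 1) := by
      apply Nat.mul_pos <;> omega
    omega
  have hnt : (S : Set (Cube K)).Nontrivial := Finset.one_lt_card_iff_nontrivial.1 hS2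
  have hsupp : σ.support = S := by
    ext x
    rw [Equiv.Perm.mem_support]
    refine ⟨fun h => ?_, fun h => hσ.apply_ne hnt h⟩
    by_contra hx
    exact h (hfix x hx)
  have hcyc : σ.IsCycle := by
    refine Equiv.Perm.isCycle_iff_exists_isCycleOn.2 ⟨S, hnt, hσ, fun x hx => ?_⟩
    by_contra h
    exact hx (hfix x h)
  -- The points of the initial axis-0 line outside `I` would all share one line along axis 0. This
  -- shear moves them to the diagonal of axes 0 and 1, so each line along axis 0 receives at most
  -- one of them, besides at most `n` points over `I`. Conjugation by it uses two more shifts.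
  let v : Equiv.Perm (Cube K) := lineShift 1 fun l => if l 0 ∈ I then 0 else l 0
  have hv : ∀ x : Cube K, v x = Function.update x 1 (x 1 + if x 0 ∈ I then 0 else x 0) :=
    fun x => rfl
  have hmem : ∀ y ∈ (v * σ * v⁻¹).support, ∃ x ∈ S, v x = y := by
    intro y hy
    rw [Equiv.Perm.support_conj, Finset.mem_map, hsupp] at hy
    simpa using hy
  have hv0 : ∀ x, v x 0 = x 0 := fun x => by rw [hv, Function.update_of_ne (by decide)]
  have h5 : ∀ y ∈ (v * σ * v⁻¹).support, y 5 = 0 := by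
    intro y hy
    obtain ⟨x, hx, rfl⟩ := hmem y hy
    rw [hv, Function.update_of_ne (by decide)]
    exact hz x hx 5 le_rfl
  refine ⟨v * σ * v⁻¹, ?_, hcyc.conj, ?_, h5, fun β => ?_⟩
  · rw [show 7 = 1 + 5 + 1 by norm_num, pow_succ _ (1 + 5), pow_add, pow_one]
    exact Set.mul_mem_mul (Set.mul_mem_mul (lineShift_mem _ _) hσ5)
      (inv_mem_shiftPerms (lineShift_mem _ _))
  · rw [Equiv.Perm.card_support_conj, hsupp, hcard]
  · calc _ ≤ (insert (β 1) I).card := by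
          refine Finset.card_le_card_of_injOn (fun y => y 0) ?_ ?_
          · intro y hy
            obtain ⟨hy, hyβ⟩ := Finset.mem_filter.1 hy
            obtain ⟨x, hx, rfl⟩ := hmem y hy
            have h1 := hyβ 1 (by decide) (by decide)
            rw [Finset.mem_coe, Finset.mem_insert]
            change v x 0 = β 1 ∨ v x 0 ∈ I
            rw [hv0]
            rcases hSI x hx with h | h
            · exact Or.inr h
            · by_cases h0 : x 0 ∈ I
              · exact Or.inr h0
              · left
                rw [← h1, hv, Function.update_self, h 1 (by decide), if_neg h0, zero_add]
          · intro y hy z hz' hyz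
            obtain ⟨hy, hyβ⟩ := Finset.mem_filter.1 hy
            obtain ⟨hz', hzβ⟩ := Finset.mem_filter.1 hz'
            funext j
            rcases eq_or_ne j 0 with rfl | h0
            · exact hyz
            · rcases eq_or_ne j 5 with rfl | h5'
              · rw [h5 y hy, h5 z hz']
              · have hj0 : 0 < j := Fin.pos_iff_ne_zero.2 h0
                have hj5 : j < 5 := lt_of_le_of_ne (Fin.le_last j) h5'
                rw [hyβ j hj0 hj5, hzβ j hj0 hj5]
      _ ≤ I.card + 1 := Finset.card_insert_le _ _
      _ = n + 1 := by rw [hI]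

end Cycle

/-! ### Routing to well spread targets -/

section Route

variable {K : ℕ} [NeZero K]

theorem exists_notMem_of_card_lt {s : Finset (ZMod K)} (h : s.card < K) : ∃ c, c ∉ s := by
  by_contra! hs
  have : s = Finset.univ := Finset.eq_univ_iff_forall.2 hs
  rw [this, Finset.card_univ, ZMod.card] at h
  exact lt_irrefl _ h

/-- If the lines along the axis `4` and the planes of the axes `4` and `5` contain few points `g a`,
then shifting lines along the axis `4` separates the projections of the `g a` along the axis `5`. -/
theorem exists_separating_shift (A : Finset (Cube K)) (g : Equiv.Perm (Cube K)) (k M : ℕ)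
    (hline : ∀ l, (A.filter fun a => (4 : Fin 6).removeNth (g a) = l).card ≤ k)
    (hplane : ∀ δ : Cube K, (A.filter fun a => ∀ j, j < 4 → g a j = δ j).card ≤ M)
    (hkM : k * M < K) :
    ∃ e ∈ shiftPerms K, (∀ x j, j ≠ 4 → e x j = x j) ∧
      ∀ a ∈ A, ∀ b ∈ A, (∀ j, j ≠ 5 → e (g a) j = e (g b) j) → a = b := by
  classical
  obtain ⟨γ, hγ⟩ := exists_greedy_choice (Finset.univ : Finset (Fin 5 → ZMod K))
    (fun v c w d => ∃ a ∈ A, ∃ b ∈ A, (4 : Fin 6).removeNth (g a) = v ∧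
      (4 : Fin 6).removeNth (g b) = w ∧ (∀ j, j < 4 → g a j = g b j) ∧ g a 4 + c = g b 4 + d)
    (by
      rintro v c w d ⟨a, ha, b, hb, hv, hw, h, h4⟩
      exact ⟨b, hb, a, ha, hw, hv, fun j hj => (h j hj).symm, h4.symm⟩)
    (by
      intro v _ γ
      by_cases hne : ∃ a₀ ∈ A, (4 : Fin 6).removeNth (g a₀) = v
      · obtain ⟨a₀, ha₀, hv₀⟩ := hne
        -- A forbidden amount for the line `v` comes from one of its at most `k` points and one of
        -- the at most `M` points in the plane of axes 4 and 5 containing it.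
        have hcard : (((A.filter fun a => (4 : Fin 6).removeNth (g a) = v) ×ˢ
            (A.filter fun b => ∀ j, j < 4 → g b j = g a₀ j)).image fun ab =>
              g ab.2 4 + γ ((4 : Fin 6).removeNth (g ab.2)) - g ab.1 4).card < K := by
          refine lt_of_le_of_lt Finset.card_image_le (lt_of_le_of_lt ?_ hkM)
          rw [Finset.card_product]
          exact Nat.mul_le_mul (hline v) (hplane _)
        obtain ⟨c, hc⟩ := exists_notMem_of_card_lt hcard
        refine ⟨c, ?_⟩
        rintro w _ _ ⟨a, ha, b, hb, hv, hw, h, h4⟩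
        refine hc (Finset.mem_image.2 ⟨(a, b), ?_, ?_⟩)
        · simp only [Finset.mem_product, Finset.mem_filter]
          refine ⟨⟨ha, hv⟩, hb, fun j hj => ?_⟩
          rw [← h j hj]
          exact (removeNth_eq_iff 4 _ _).1 (hv.trans hv₀.symm) j hj.ne
        · simp only [hw]
          rw [← h4]
          ring
      · refine ⟨0, ?_⟩
        rintro w _ _ ⟨a, ha, b, hb, hv, -⟩
        exact hne ⟨a, ha, hv⟩)
  have hne4 : ∀ x j, j ≠ 4 → lineShift 4 γ x j = x j := fun x j hj => by
    rw [lineShift_apply, Function.update_of_ne hj]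
  have h4 : ∀ x, lineShift 4 γ x 4 = x 4 + γ ((4 : Fin 6).removeNth x) := fun x => by
    rw [lineShift_apply, Function.update_self]
  refine ⟨lineShift 4 γ, lineShift_mem 4 γ, hne4, fun a ha b hb hab => ?_⟩
  have hab4 := hab 4 (by decide)
  rw [h4, h4] at hab4
  by_cases hl : (4 : Fin 6).removeNth (g a) = (4 : Fin 6).removeNth (g b)
  · rw [hl, add_left_inj] at hab4
    refine g.injective (funext fun j => ?_)
    by_cases hj : j = 4
    · rw [hj, hab4]
    · exact (removeNth_eq_iff 4 _ _).1 hl j hj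
  · refine absurd ⟨a, ha, b, hb, rfl, rfl, fun j hj => ?_, hab4⟩
      (hγ _ (Finset.mem_univ _) _ (Finset.mem_univ _) hl)
    have := hab j (hj.trans (by decide)).ne
    rwa [hne4 _ j hj.ne, hne4 _ j hj.ne] at this

/-- The targets are routed to `e (g a)` by 7 shifts, then `e⁻¹` is applied. A conflict at stage `s <
5` involves only target coordinates below 4, which `e` does not change, so the loads of `g` itself
control the choice of `r`: at most `M` forbidden values for each of the five stages. -/
theorem exists_word_eq_on (A : Finset (Cube K)) (g : Equiv.Perm (Cube K)) (k M : ℕ)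
    (hA5 : ∀ a ∈ A, a 5 = 0)
    (hline : ∀ l, (A.filter fun a => (4 : Fin 6).removeNth (g a) = l).card ≤ k)
    (hload : ∀ s : Fin 6, s < 5 → ∀ β δ : Cube K,
      (A.filter fun a => (∀ j, s < j → j < 5 → a j = β j) ∧ ∀ j, j < s → g a j = δ j).card ≤ M)
    (hkM : k * M < K) (h5M : 5 * M < K) :
    ∃ w ∈ shiftPerms K ^ 8, ∀ a ∈ A, w a = g a := by
  classical
  have hplane : ∀ δ : Cube K, (A.filter fun a => ∀ j, j < 4 → g a j = δ j).card ≤ M := by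
    intro δ
    -- For `s = 4` no index lies strictly between `s` and 5, so the condition on `a` is vacuous.
    convert hload 4 (by decide) 0 δ using 3
    symm
    refine and_iff_right ?_
    intro j h4 h5
    rw [Fin.lt_def] at h4 h5
    have h4' : 4 < j.val := h4
    have h5' : j.val < 5 := h5
    omega
  obtain ⟨e, he, hkeep, hsep⟩ := exists_separating_shift A g k M hline hplane hkM
  obtain ⟨r, hr⟩ := exists_greedy_choice A
    (fun a (c : ZMod K) b d => c = d ∧ ∃ s : Fin 6, s < 5 ∧ (∀ j, j < s → g a j = g b j) ∧
      ∀ j, s < j → j < 5 → a j = b j)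
    (by
      rintro a c b d ⟨hcd, s, hs, h1, h2⟩
      exact ⟨hcd.symm, s, hs, fun j hj => (h1 j hj).symm, fun j hj hj' => (h2 j hj hj').symm⟩)
    (by
      intro a _ r
      have hcard : ((((Finset.univ : Finset (Fin 6)).filter (· < 5)).biUnion fun s =>
          A.filter fun b => (∀ j, s < j → j < 5 → b j = a j) ∧
            ∀ j, j < s → g b j = g a j).image r).card < K := by
        refine lt_of_le_of_lt Finset.card_image_le (lt_of_le_of_lt Finset.card_biUnion_le ?_)
        refine lt_of_le_of_lt (Finset.sum_le_card_nsmul _ _ M fun s hs => ?_) ?_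
        · exact hload s (Finset.mem_filter.1 hs).2 a (g a)
        · rw [show ((Finset.univ : Finset (Fin 6)).filter (· < 5)).card = 5 by decide]
          exact h5M
      obtain ⟨c, hc⟩ := exists_notMem_of_card_lt hcard
      refine ⟨c, ?_⟩
      rintro b hb _ ⟨rfl, s, hs, h1, h2⟩
      refine hc (Finset.mem_image_of_mem r (Finset.mem_biUnion.2 ⟨s, by simpa using hs, ?_⟩))
      exact Finset.mem_filter.2 ⟨hb, fun j hj hj' => (h2 j hj hj').symm,
        fun j hj => (h1 j hj).symm⟩)
  obtain ⟨w, hw, hwA⟩ := exists_route A (fun a => e (g a))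
    (by
      intro a ha b hb hab
      funext j
      by_cases hj : j = 5
      · rw [hj, hA5 a ha, hA5 b hb]
      · exact hab j hj)
    hsep r
    (by
      intro a ha b hb hne s hs h1 h2 hrab
      refine hr a ha b hb hne ⟨hrab, s, hs, fun j hj => ?_, h2⟩
      have hj4 : j ≠ 4 := by
        rintro rfl
        have h4 : (4 : ℕ) < s.val := hj
        have h5 : s.val < 5 := hs
        omega
      have := h1 j hj
      rwa [hkeep _ j hj4, hkeep _ j hj4] at this)
  refine ⟨e⁻¹ * w, ?_, fun a ha => by rw [Equiv.Perm.mul_apply, hwA a ha]; simp⟩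
  rw [pow_succ' _ 7]
  exact Set.mul_mem_mul (inv_mem_shiftPerms he) hw

end Route

/-! ### Most permutations spread the support -/

section Spread

variable {K : ℕ} [NeZero K]

/-- A pair `(a, y)` is encoded by the single cube point `(a 1, …, a s, y s, …, y 5)`. Together with
the prescribed coordinates this determines `y` and coordinates 1 to 4 of `a`, leaving at most `F`
choices. Hence the mean load is at most `F` at every stage `s`. -/
theorem card_mul_card_prefix_le (A : Finset (Cube K)) (F : ℕ)
    (hF : ∀ β : Cube K, (A.filter fun a => ∀ j, 0 < j → j < 5 → a j = β j).card ≤ F)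
    (s : Fin 6) (β δ : Cube K) :
    (A.filter fun a => ∀ j, s < j → j < 5 → a j = β j).card *
      ((Finset.univ : Finset (Cube K)).filter fun y => ∀ j, j < s → y j = δ j).card ≤
        F * K ^ 6 := by
  classical
  rw [← Finset.card_product]
  refine (Finset.card_le_mul_card_image
    (f := fun p : Cube K × Cube K => fun j => if j < s then p.1 (j + 1) else p.2 j) _ F ?_).trans
    (Nat.mul_le_mul_left F ((Finset.card_le_univ _).trans_eq ?_))
  · intro z hz
    obtain ⟨⟨a₀, y₀⟩, h₀, rfl⟩ := Finset.mem_image.1 hz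
    refine (Finset.card_le_card_of_injOn Prod.fst ?_ ?_).trans (hF a₀)
    · rintro ⟨a, y⟩ hp
      simp only [Finset.coe_filter, Finset.mem_product, Finset.mem_filter, Set.mem_ofPred_eq] at hp h₀ ⊢
      refine ⟨hp.1.1.1, fun j h0 h5 => ?_⟩
      rcases lt_or_ge s j with h | h
      · rw [hp.1.1.2 j h h5, h₀.1.2 j h h5]
      · have hlt : j - 1 < s := lt_of_lt_of_le (Fin.sub_one_lt_iff.2 h0) h
        have := congrFun hp.2 (j - 1)
        simpa [hlt] using this
    · rintro ⟨a, y⟩ hp ⟨a', y'⟩ hp' haa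
      simp only [Finset.coe_filter, Finset.mem_product, Finset.mem_filter, Set.mem_ofPred_eq,
        Finset.mem_univ, true_and] at hp hp' haa
      refine Prod.ext haa (funext fun j => ?_)
      by_cases hj : j < s
      · change y j = y' j
        rw [hp.1.2 j hj, hp'.1.2 j hj]
      · have := congrFun (hp.2.trans hp'.2.symm) j
        simpa [hj] using this
  · rw [Fintype.card_fun, ZMod.card, Fintype.card_fin]

theorem card_removeNth_eq (l : Fin 5 → ZMod K) (i : Fin 6) :
    ((Finset.univ : Finset (Cube K)).filter fun y => i.removeNth y = l).card = K := by
  classical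
  have : ((Finset.univ : Finset (Cube K)).filter fun y => i.removeNth y = l) =
      Finset.univ.image fun c => i.insertNth c l := by
    ext y
    simp only [Finset.mem_filter, Finset.mem_univ, true_and, Finset.mem_image]
    constructor
    · rintro rfl
      exact ⟨y i, by simp⟩
    · rintro ⟨c, rfl⟩
      simp
  rw [this, Finset.card_image_of_injective, Finset.card_univ, ZMod.card]
  intro c c' h
  simpa using congrFun h i

/-- Two union bounds: over the `K ^ 5` lines, with mean `|A| / K ^ 5`, and over the triples `(s, β,
δ)`, with mean at most `F`. Letting `β` and `δ` run over the whole cube is wasteful, but the factor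
`6 * K ^ 12` is harmless against the second tail. -/
theorem card_not_spread_le (A : Finset (Cube K)) (F k m : ℕ)
    (hF : ∀ β : Cube K, (A.filter fun a => ∀ j, 0 < j → j < 5 → a j = β j).card ≤ F) :
    ((Finset.univ.filter fun g : Equiv.Perm (Cube K) =>
      ¬ ((∀ l, (A.filter fun a => (4 : Fin 6).removeNth (g a) = l).card < k) ∧
        ∀ s : Fin 6, s < 5 → ∀ β δ : Cube K,
          (A.filter fun a => (∀ j, s < j → j < 5 → a j = β j) ∧
            ∀ j, j < s → g a j = δ j).card < m)).card : ℝ) ≤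
      ((K : ℝ) ^ 5 * (((A.card : ℝ) / (K : ℝ) ^ 5) ^ k / k.factorial) +
        6 * (K : ℝ) ^ 12 * ((F : ℝ) ^ m / m.factorial)) *
          Fintype.card (Equiv.Perm (Cube K)) := by
  classical
  have hN : Fintype.card (Cube K) = K ^ 6 := by
    rw [Fintype.card_fun, ZMod.card, Fintype.card_fin]
  have hK0 : (K : ℝ) ≠ 0 := by exact_mod_cast NeZero.ne K
  have h1 := card_perm_exists_load_le (α := Cube K) (Finset.univ : Finset (Fin 5 → ZMod K))
    (fun _ => A) (fun l => Finset.univ.filter fun y => (4 : Fin 6).removeNth y = l) k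
    ((A.card : ℝ) / (K : ℝ) ^ 5) (by
      intro l _
      rw [card_removeNth_eq, hN]
      push_cast
      refine le_of_eq ?_
      field_simp)
  have h2 := card_perm_exists_load_le (α := Cube K)
    (Finset.univ : Finset (Fin 6 × Cube K × Cube K))
    (fun p => A.filter fun a => ∀ j, p.1 < j → j < 5 → a j = p.2.1 j)
    (fun p => Finset.univ.filter fun y => ∀ j, j < p.1 → y j = p.2.2 j) m F (by
      intro p _
      rw [hN]
      exact_mod_cast card_mul_card_prefix_le A F hF p.1 p.2.1 p.2.2)
  have hc1 : ((Finset.univ : Finset (Fin 5 → ZMod K)).card : ℝ) = (K : ℝ) ^ 5 := by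
    rw [Finset.card_univ, Fintype.card_fun, ZMod.card, Fintype.card_fin]
    push_cast; rfl
  have hc2 : ((Finset.univ : Finset (Fin 6 × Cube K × Cube K)).card : ℝ) = 6 * (K : ℝ) ^ 12 := by
    rw [Finset.card_univ, Fintype.card_prod, Fintype.card_prod, hN, Fintype.card_fin]
    push_cast; ring
  rw [hc1] at h1
  rw [hc2] at h2
  rw [add_mul]
  refine le_trans ?_ (add_le_add h1 h2)
  rw [← Nat.cast_add, Nat.cast_le]
  refine le_trans (Finset.card_le_card ?_) (Finset.card_union_le _ _)
  intro g hg
  have hg := (Finset.mem_filter.1 hg).2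
  rw [Finset.mem_union, Finset.mem_filter, Finset.mem_filter]
  by_contra hcon
  push Not at hcon
  refine hg ⟨fun l => ?_, fun s _ β δ => ?_⟩
  · have := hcon.1 (Finset.mem_univ _) l (Finset.mem_univ _)
    simpa using this
  · have := hcon.2 (Finset.mem_univ _) (s, β, δ) (Finset.mem_univ _)
    simpa [Finset.filter_filter] using this

end Spread

/-! ### Numerical estimates -/

theorem exp_thirteen_bounds : (400000 : ℝ) ≤ Real.exp 13 ∧ Real.exp 13 ≤ 10 ^ 6 := by
  have h : Real.exp 13 = Real.exp 1 ^ 13 := by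
    rw [← Real.exp_nat_mul]; norm_num
  have h1 := Real.exp_one_gt_d9
  have h2 := Real.exp_one_lt_d9
  rw [h]
  constructor
  · calc (400000 : ℝ) ≤ 2.718 ^ 13 := by norm_num
      _ ≤ _ := by gcongr; linarith
  · calc Real.exp 1 ^ 13 ≤ 2.719 ^ 13 := by gcongr; linarith
      _ ≤ _ := by norm_num

theorem thirteen_le_log {K : ℝ} (hK : 10 ^ 6 ≤ K) : 13 ≤ Real.log K := by
  rw [Real.le_log_iff_exp_le (by linarith)]
  exact exp_thirteen_bounds.2.trans hK

theorem quadratic_le_of_log {K : ℝ} (hK : 10 ^ 6 ≤ K) :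
    400000 * (1 + (Real.log K - 13) + (Real.log K - 13) ^ 2 / 2) ≤ K := by
  have h13 := thirteen_le_log hK
  have h := Real.quadratic_le_exp_of_nonneg (sub_nonneg.2 h13)
  calc _ ≤ Real.exp 13 * Real.exp (Real.log K - 13) :=
        mul_le_mul exp_thirteen_bounds.1 h (by nlinarith) (by positivity)
    _ = K := by
        rw [← Real.exp_add, add_sub_cancel, Real.exp_log (by linarith)]

theorem le_div_log {K : ℝ} (hK : 10 ^ 6 ≤ K) : 30000 ≤ K / Real.log K := by
  have h13 := thirteen_le_log hK
  have h := quadratic_le_of_log hK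
  rw [le_div_iff₀ (by linarith)]
  nlinarith [sq_nonneg (Real.log K - 13)]

/-- Here 149 bounds `exp 5`, and `i + 13` will be `⌊log K⌋₊`. Passing from `i` to `i + 1` multiplies
the left side by 149 and the right side by at least 3 * 14 * 15 = 630. -/
theorem pow_mul_le_pow_mul_factorial (i : ℕ) :
    500 * 149 ^ (i + 14) ≤ (3 * (i + 13)) ^ (i + 14) * (i + 14).factorial := by
  induction i with
  | zero => norm_num [Nat.factorial]
  | succ i ih =>
    have h1 : (3 * (i + 13)) ^ (i + 14) ≤ (3 * (i + 14)) ^ (i + 14) := by gcongr; omega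
    calc 500 * 149 ^ (i + 1 + 14) = 149 * (500 * 149 ^ (i + 14)) := by ring
      _ ≤ (3 * (i + 14) * (i + 15)) * ((3 * (i + 14)) ^ (i + 14) * (i + 14).factorial) := by
          refine Nat.mul_le_mul (by nlinarith) (ih.trans ?_)
          gcongr
      _ = (3 * (i + 1 + 13)) ^ (i + 1 + 14) * (i + 1 + 14).factorial := by
          rw [show (i + 1 + 14).factorial = (i + 15) * (i + 14).factorial from
            Nat.factorial_succ (i + 14), show i + 1 + 14 = (i + 14) + 1 by ring,
            show i + 1 + 13 = i + 14 by ring, pow_succ]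
          generalize (i + 14).factorial = f
          generalize (3 * (i + 14)) ^ (i + 14) = p
          ring

theorem line_term_le {K μ : ℝ} (hK : 10 ^ 6 ≤ K) (hμ0 : 0 ≤ μ) (hμ : μ ≤ 1 / (3 * Real.log K)) :
    K ^ 5 * (μ ^ (⌊Real.log K⌋₊ + 1) / (⌊Real.log K⌋₊ + 1).factorial) ≤ 1 / 500 := by
  have h13 := thirteen_le_log hK
  have hk13 : 13 ≤ ⌊Real.log K⌋₊ := Nat.le_floor (by exact_mod_cast h13)
  obtain ⟨i, hi⟩ := Nat.exists_eq_add_of_le' hk13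
  have hle : ((i : ℝ) + 13) ≤ Real.log K := by
    have := Nat.floor_le (show 0 ≤ Real.log K by linarith)
    rw [hi] at this
    exact_mod_cast this
  have hlt : Real.log K < (i : ℝ) + 14 := by
    have := Nat.lt_floor_add_one (Real.log K)
    rw [hi] at this
    push_cast at this
    linarith
  rw [hi, show i + 13 + 1 = i + 14 by ring]
  have hexp5 : Real.exp 5 ≤ 149 := by
    have h : Real.exp 5 = Real.exp 1 ^ 5 := by
      rw [← Real.exp_nat_mul]; norm_num
    have h2 := Real.exp_one_lt_d9
    rw [h]
    calc Real.exp 1 ^ 5 ≤ 2.719 ^ 5 := by gcongr; linarith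
      _ ≤ _ := by norm_num
  have hK5 : K ^ 5 ≤ 149 ^ (i + 14) := by
    calc K ^ 5 = Real.exp (Real.log K) ^ 5 := by rw [Real.exp_log (by linarith)]
      _ = Real.exp (5 * Real.log K) := by rw [← Real.exp_nat_mul]; norm_num
      _ ≤ Real.exp (((i + 14 : ℕ) : ℝ) * 5) := by
          apply Real.exp_le_exp.2
          push_cast
          linarith
      _ = Real.exp 5 ^ (i + 14) := by rw [Real.exp_nat_mul]
      _ ≤ _ := by gcongr
  have hμ' : μ ≤ 1 / (3 * ((i : ℝ) + 13)) := hμ.trans (by gcongr)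
  have hnat : (500 : ℝ) * 149 ^ (i + 14) ≤
      (3 * ((i : ℝ) + 13)) ^ (i + 14) * (i + 14).factorial := by
    exact_mod_cast pow_mul_le_pow_mul_factorial i
  calc _ ≤ (149 : ℝ) ^ (i + 14) *
        ((1 / (3 * ((i : ℝ) + 13))) ^ (i + 14) / (i + 14).factorial) := by gcongr
    _ = 149 ^ (i + 14) / ((3 * ((i : ℝ) + 13)) ^ (i + 14) * (i + 14).factorial) := by
        rw [div_pow, one_pow]
        field_simp
    _ ≤ 1 / 500 := by
        rw [div_le_div_iff₀ (by positivity) (by norm_num)]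
        linarith

/-- Since `m ^ m / m! ≤ exp m`, the tail is at most `(5/14 * e) ^ m`. The constant 5/14 lies above
the true density 1/3 but below `1/e`, so this decays exponentially in `K / log K` and beats the
power of `K`. -/
theorem plane_term_le {K F : ℝ} (hK : 10 ^ 6 ≤ K) (hF0 : 0 ≤ F)
    (hF : F ≤ 5 / 14 * (K / Real.log K)) :
    6 * K ^ 12 * (F ^ ⌈K / Real.log K⌉₊ / (⌈K / Real.log K⌉₊).factorial) ≤ 1 / 1000 := by
  have h13 := thirteen_le_log hK
  have hq := quadratic_le_of_log hK
  set x := Real.log K with hx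
  set m := ⌈K / x⌉₊
  have hm : K / x ≤ m := Nat.le_ceil _
  have hfac : (F ^ m / m.factorial) ≤ Real.exp (-0.029 * m) := by
    calc F ^ m / m.factorial ≤ (5 / 14 * (m : ℝ)) ^ m / m.factorial := by
          gcongr
          linarith
      _ = (5 / 14) ^ m * ((m : ℝ) ^ m / m.factorial) := by rw [mul_pow, mul_div_assoc]
      _ ≤ (5 / 14) ^ m * Real.exp m := by
          gcongr
          exact Real.pow_div_factorial_le_exp _ (by positivity) _
      _ = (5 / 14 * Real.exp 1) ^ m := by rw [mul_pow, ← Real.exp_nat_mul, mul_one]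
      _ ≤ Real.exp (-0.029) ^ m := by
          gcongr
          have h1 := Real.add_one_le_exp (-0.029 : ℝ)
          have h2 := Real.exp_one_lt_d9
          linarith
      _ = _ := by rw [← Real.exp_nat_mul]; congr 1; ring
  have hK12 : K ^ 12 = Real.exp (12 * x) := by
    rw [hx, show (12 : ℝ) * Real.log K = ((12 : ℕ) : ℝ) * Real.log K by norm_num, Real.exp_nat_mul,
      Real.exp_log (by linarith)]
  have hy : 12 * x + 10 ≤ 0.029 * (K / x) := by
    rw [← mul_div_assoc, le_div_iff₀ (by linarith)]
    nlinarith [sq_nonneg (x - 13)]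
  have hexp10 : Real.exp (-10) ≤ 1 / 6000 := by
    have h : Real.exp 10 = Real.exp 1 ^ 10 := by
      rw [← Real.exp_nat_mul]; norm_num
    have h1 := Real.exp_one_gt_d9
    rw [Real.exp_neg, inv_eq_one_div, h]
    apply one_div_le_one_div_of_le (by norm_num)
    calc (6000 : ℝ) ≤ 2.7 ^ 10 := by norm_num
      _ ≤ _ := by gcongr; linarith
  calc _ ≤ 6 * Real.exp (12 * x) * Real.exp (-0.029 * m) := by
        rw [hK12]; gcongr
    _ = 6 * Real.exp (12 * x + -0.029 * m) := by rw [Real.exp_add]; ring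
    _ ≤ 6 * Real.exp (-10) := by
        gcongr
        linarith
    _ ≤ 1 / 1000 := by linarith

/-- The parameters of the cycles: `a` determines the length, `n` the width of the support. -/
theorem exists_parameters (K : ℕ) (hK : 10 ^ 6 < K) :
    ∃ a n : ℕ, ((1 + a * (K - 1) : ℕ) : ℝ) < (K : ℝ) ^ 5 / (3 * Real.log K) ∧
      (K : ℝ) ^ 5 / (3 * Real.log K) ≤ ((1 + (a + 1) * (K - 1) : ℕ) : ℝ) ∧ n ≤ K ∧
      1 + n * (1 + K + K ^ 2) ≤ a ∧ a ≤ 1 + n * (1 + K + K ^ 2 + K ^ 3) ∧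
      ((n + 1 : ℕ) : ℝ) ≤ 5 / 14 * (K / Real.log K) := by
  have hKr : (10 : ℝ) ^ 6 ≤ K := by exact_mod_cast hK.le
  have h13 := thirteen_le_log hKr
  have hy := le_div_log hKr
  have hX : (K : ℝ) ^ 5 / (3 * Real.log K) = K ^ 4 * (K / Real.log K) / 3 := by
    field_simp
  rw [hX]
  set y := (K : ℝ) / Real.log K
  have hyK : y ≤ K := div_le_self (by linarith) (by linarith)
  have hK4 : (10 : ℝ) ^ 6 ≤ K ^ 4 := hKr.trans (le_self_pow₀ (by linarith) (by norm_num))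
  have hKK4 : (K : ℝ) ≤ K ^ 4 := le_self_pow₀ (by linarith) (by norm_num)
  have hcast : ∀ b : ℕ, ((1 + b * (K - 1) : ℕ) : ℝ) = 1 + b * ((K : ℝ) - 1) := by
    intro b
    push_cast [Nat.cast_sub (show 1 ≤ K by omega)]
    ring
  have hex : ∃ b : ℕ, (K : ℝ) ^ 4 * y / 3 ≤ ((1 + b * (K - 1) : ℕ) : ℝ) := by
    obtain ⟨b, hb⟩ := exists_nat_ge ((K : ℝ) ^ 4 * y / 3)
    refine ⟨b, hb.trans ?_⟩
    rw [hcast]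
    nlinarith [(Nat.cast_nonneg b : (0 : ℝ) ≤ b)]
  have hbig : 10000 * (K : ℝ) ^ 4 ≤ K ^ 4 * y / 3 := by nlinarith
  classical
  -- The first length reaching the bound has index `a + 1`, so index `a` gives the largest
  -- admissible length.
  obtain ⟨a, ha⟩ : ∃ a, Nat.find hex = a + 1 := by
    refine Nat.exists_eq_succ_of_ne_zero fun h0 => ?_
    have := Nat.find_spec hex
    rw [h0] at this
    norm_num at this
    linarith
  have ha2 : (K : ℝ) ^ 4 * y / 3 ≤ ((1 + (a + 1) * (K - 1) : ℕ) : ℝ) := ha ▸ Nat.find_spec hex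
  have ha1 : ((1 + a * (K - 1) : ℕ) : ℝ) < (K : ℝ) ^ 4 * y / 3 :=
    not_le.1 (Nat.find_min hex (by omega))
  have hex2 : ∃ n : ℕ, a ≤ 1 + n * (1 + K + K ^ 2 + K ^ 3) := ⟨a, by nlinarith [Nat.zero_le (a * (K + K ^ 2 + K ^ 3))]⟩
  -- The width is the least one whose slabs can hold `a` lines. It must be at least 2, so that the
  -- lower bound on `a` from minimality contains a spare `K ^ 3`, which pays for the term `1 + K + K
  -- ^ 2` of the last unit of width.
  have hbelow : ∀ n < 2, ¬ a ≤ 1 + n * (1 + K + K ^ 2 + K ^ 3) := by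
    intro n hn h
    have h' : (a : ℝ) ≤ 1 + 1 * (1 + K + K ^ 2 + K ^ 3) := by
      have : a ≤ 1 + 1 * (1 + K + K ^ 2 + K ^ 3) :=
        h.trans (by gcongr; omega)
      exact_mod_cast this
    rw [hcast] at ha2
    push_cast at ha2
    have h3 : ((a : ℝ) + 1) * ((K : ℝ) - 1) ≤
        (1 + 1 * (1 + K + K ^ 2 + K ^ 3) + 1) * ((K : ℝ) - 1) := by
      gcongr
      linarith
    nlinarith
  obtain ⟨n, hn⟩ : ∃ n, Nat.find hex2 = n + 2 := by
    refine ⟨Nat.find hex2 - 2, ?_⟩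
    have := (Nat.le_find_iff hex2 2).2 hbelow
    omega
  have hn2 : a ≤ 1 + (n + 2) * (1 + K + K ^ 2 + K ^ 3) := hn ▸ Nat.find_spec hex2
  have hn1 : 1 + (n + 1) * (1 + K + K ^ 2 + K ^ 3) < a :=
    not_le.1 (Nat.find_min hex2 (by omega))
  have hbound : ((n + 2 + 1 : ℕ) : ℝ) ≤ 5 / 14 * y := by
    have h1 : ((n : ℝ) + 1) * (1 + K + K ^ 2 + K ^ 3) ≤ a := by
      have : (n + 1) * (1 + K + K ^ 2 + K ^ 3) ≤ a := by omega
      exact_mod_cast this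
    rw [hcast] at ha1
    have h2 : ((n : ℝ) + 1) * (1 + K + K ^ 2 + K ^ 3) * ((K : ℝ) - 1) ≤ a * ((K : ℝ) - 1) := by
      gcongr
      linarith
    -- Uses `(1 + K + K ^ 2 + K ^ 3) * (K - 1) = K ^ 4 - 1`. The width is thus about `y / 3`, and
    -- the gap between 1/3 and 5/14 absorbs the rounding because `y ≥ 30000`.
    have h3 : ((n : ℝ) + 1) * ((K : ℝ) ^ 4 - 1) < K ^ 4 * y / 3 := by nlinarith
    have h4 : ((n : ℝ) + 1) * (0.9999 * (K : ℝ) ^ 4) ≤ ((n : ℝ) + 1) * ((K : ℝ) ^ 4 - 1) := by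
      gcongr
      linarith
    have h5 : ((n : ℝ) + 1) * 0.9999 < y / 3 := by
      refine lt_of_mul_lt_mul_right (a := (K : ℝ) ^ 4) ?_ (by positivity)
      linarith
    push_cast
    linarith
  refine ⟨a, n + 2, ha1, ha2, ?_, ?_, hn2, hbound⟩
  · have : ((n + 2 : ℕ) : ℝ) ≤ K := by
      push_cast at hbound ⊢
      linarith
    exact_mod_cast this
  · have hK1 : K ^ 3 ≥ 1 + K + K ^ 2 := by nlinarith [sq_nonneg K]
    nlinarith [Nat.zero_le (n * K ^ 3)]

/-! ### Conjugates of the spread cycle and the conclusion -/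

theorem isCycle_and_card_support_iff_isConj {α : Type*} [Fintype α] [DecidableEq α]
    {c : Equiv.Perm α} (hc : c.IsCycle) (y : Equiv.Perm α) :
    y.IsCycle ∧ y.support.card = c.support.card ↔ IsConj c y := by
  constructor
  · rintro ⟨h1, h2⟩
    exact (hc.isConj_iff h1).2 h2.symm
  · intro h
    obtain ⟨g, rfl⟩ := isConj_iff.1 h
    exact ⟨hc.conj, Equiv.Perm.card_support_conj⟩

/-- All but a small part of the conjugators `g` bring a cycle with well spread support into a ball
of small radius. -/
theorem card_conj_notMem_le {K : ℕ} [NeZero K] (hK : 10 ^ 6 < K) {c : Equiv.Perm (Cube K)} {n : ℕ}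
    [DecidablePred fun e : Equiv.Perm (Cube K) => e ∈ shiftPerms K ^ 47]
    (hc7 : c ∈ shiftPerms K ^ 7) (h5 : ∀ x ∈ c.support, x 5 = 0)
    (hF : ∀ β : Cube K,
      (c.support.filter fun x => ∀ j, 0 < j → j < 5 → x j = β j).card ≤ n + 1)
    (hn : ((n + 1 : ℕ) : ℝ) ≤ 5 / 14 * (K / Real.log K))
    (hL : (c.support.card : ℝ) < (K : ℝ) ^ 5 / (3 * Real.log K)) :
    ((Finset.univ.filter fun g : Equiv.Perm (Cube K) =>
      g * c * g⁻¹ ∉ shiftPerms K ^ 47).card : ℝ) ≤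
        1 / 100 * Fintype.card (Equiv.Perm (Cube K)) := by
  have hKr : (10 : ℝ) ^ 6 ≤ K := by exact_mod_cast hK.le
  have h13 := thirteen_le_log hKr
  have hy := le_div_log hKr
  set x := Real.log K with hx
  have hx0 : 0 < x := by linarith
  set m := ⌈(K : ℝ) / x⌉₊ with hm
  -- Loads below `m` are at most `m - 1`, which is strictly less than `K / log K`; this strictness
  -- gives `⌊x⌋₊ * (m - 1) < K`, as the greedy choices require.
  have hm1 : ((m - 1 : ℕ) : ℝ) < K / x := by
    have h1 : 0 < m := Nat.ceil_pos.2 (by linarith)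
    have h2 : m - 1 < m := by omega
    exact Nat.lt_ceil.1 h2
  have hk : ((⌊x⌋₊ : ℕ) : ℝ) ≤ x := Nat.floor_le hx0.le
  have hKx : (K : ℝ) / x * x = K := div_mul_cancel₀ _ hx0.ne'
  have hkM : ⌊x⌋₊ * (m - 1) < K := by
    have : ((⌊x⌋₊ * (m - 1) : ℕ) : ℝ) < K := by
      rw [Nat.cast_mul]
      calc ((⌊x⌋₊ : ℕ) : ℝ) * ((m - 1 : ℕ) : ℝ) ≤ x * ((m - 1 : ℕ) : ℝ) := by gcongr
        _ < x * (K / x) := by gcongr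
        _ = K := by rw [mul_comm, hKx]
    exact_mod_cast this
  have h5M : 5 * (m - 1) < K := by
    have : ((5 * (m - 1) : ℕ) : ℝ) < K := by
      rw [Nat.cast_mul]
      calc ((5 : ℕ) : ℝ) * ((m - 1 : ℕ) : ℝ) ≤ x * ((m - 1 : ℕ) : ℝ) := by
            gcongr
            push_cast
            linarith
        _ < x * (K / x) := by gcongr
        _ = K := by rw [mul_comm, hKx]
    exact_mod_cast this
  have hnm : n + 1 ≤ m - 1 := by
    have h1 : ((n + 1 + 1 : ℕ) : ℝ) ≤ (m : ℝ) := by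
      refine le_trans ?_ (Nat.le_ceil _)
      push_cast at hn ⊢
      linarith
    have h2 : n + 1 + 1 ≤ m := by exact_mod_cast h1
    omega
  have hspread := card_not_spread_le c.support (n + 1) (⌊x⌋₊ + 1) m hF
  have hline := line_term_le hKr (μ := (c.support.card : ℝ) / (K : ℝ) ^ 5) (by positivity) (by
    rw [div_le_iff₀ (by positivity), one_div_mul_eq_div]
    exact hL.le)
  have hplane := plane_term_le hKr (Nat.cast_nonneg (n + 1)) hn
  have hsub : (Finset.univ.filter fun g : Equiv.Perm (Cube K) =>
      g * c * g⁻¹ ∉ shiftPerms K ^ 47) ⊆ Finset.univ.filter fun g : Equiv.Perm (Cube K) =>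
      ¬ ((∀ l, (c.support.filter fun a => (4 : Fin 6).removeNth (g a) = l).card < ⌊x⌋₊ + 1) ∧
        ∀ s : Fin 6, s < 5 → ∀ β δ : Cube K,
          (c.support.filter fun a => (∀ j, s < j → j < 5 → a j = β j) ∧
            ∀ j, j < s → g a j = δ j).card < m) := by
    intro g hg
    rw [Finset.mem_filter] at hg ⊢
    refine ⟨Finset.mem_univ _, fun hgood => hg.2 ?_⟩
    obtain ⟨w, hw, hwA⟩ := exists_word_eq_on c.support g ⌊x⌋₊ (m - 1) h5
      (fun l => Nat.lt_succ_iff.1 (hgood.1 l))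
      (fun s hs β δ => Nat.le_sub_one_of_lt (hgood.2 s hs β δ)) hkM h5M
    have hconj : g * c * g⁻¹ = w * c * w⁻¹ := by
      -- `w⁻¹ * g` fixes the support of `c` pointwise, so the two permutations are disjoint and
      -- commute.
      have hcomm : (w⁻¹ * g) * c = c * (w⁻¹ * g) := by
        refine Equiv.Perm.Disjoint.commute (fun z => ?_)
        by_cases hz : z ∈ c.support
        · left
          rw [Equiv.Perm.mul_apply, ← hwA z hz]
          simp
        · right
          exact Equiv.Perm.notMem_support.1 hz
      calc g * c * g⁻¹ = w * ((w⁻¹ * g) * c) * g⁻¹ := by group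
        _ = w * c * w⁻¹ := by rw [hcomm]; group
    rw [hconj]
    have h23 : w * c * w⁻¹ ∈ shiftPerms K ^ (8 + 7 + 8) := by
      rw [pow_add, pow_add]
      exact Set.mul_mem_mul (Set.mul_mem_mul hw hc7) (inv_mem_shiftPerms_pow hw)
    exact Set.pow_subset_pow_right one_mem_shiftPerms (by norm_num) h23
  have hP : (0 : ℝ) ≤ Fintype.card (Equiv.Perm (Cube K)) := Nat.cast_nonneg _
  calc _ ≤ _ := Nat.cast_le.2 (Finset.card_le_card hsub)
    _ ≤ _ := hspread
    _ ≤ (1 / 500 + 1 / 1000) * Fintype.card (Equiv.Perm (Cube K)) := by gcongr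
    _ ≤ _ := by gcongr; norm_num

theorem mainTheorem6 (K : ℕ) [NeZero K] (hK : Odd K) (hK6 : 10 ^ 6 < K) :
    ∃ L : ℕ,
      IsGreatest {m : ℕ | (∃ a : ℕ, m = 1 + a * (K - 1)) ∧
        (m : ℝ) < (K : ℝ) ^ 5 / (3 * Real.log (K : ℝ))} L ∧
      (∃ c : ConjClasses (alternatingGroup (Cube K)), c.carrier = cyclesOfLength K L) ∧
      ((cyclesOfLength K L \ lineShifts hK ^ 47).ncard : ℝ) ≤
        (1 / 100 : ℝ) * ((cyclesOfLength K L).ncard : ℝ) := by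
  classical
  have hKr : (10 : ℝ) ^ 6 ≤ K := by exact_mod_cast hK6.le
  have h13 := thirteen_le_log hKr
  obtain ⟨a, n, ha1, ha2, hnK, hna, han, hn⟩ := exists_parameters K hK6
  obtain ⟨c, hc7, hcyc, hcard, h5, hF⟩ := exists_cycle_spread n a hnK (by omega) hna han
  obtain ⟨c', -, rfl⟩ : c ∈ (alternatingGroup (Cube K)).subtype '' (lineShifts hK ^ 7) := by
    rwa [image_lineShifts_pow]
  rw [Subgroup.subtype_apply] at *
  have hmem : ∀ y : alternatingGroup (Cube K), y ∈ cyclesOfLength K (1 + a * (K - 1)) ↔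
      IsConj (c' : Equiv.Perm (Cube K)) y := by
    intro y
    rw [← isCycle_and_card_support_iff_isConj hcyc, hcard]
    rfl
  refine ⟨1 + a * (K - 1), ⟨⟨⟨a, rfl⟩, ha1⟩, ?_⟩, ⟨ConjClasses.mk c', ?_⟩, ?_⟩
  · rintro m ⟨⟨b, rfl⟩, hb⟩
    have h1 : 1 + b * (K - 1) < 1 + (a + 1) * (K - 1) := by exact_mod_cast hb.trans_le ha2
    have h2 : b < a + 1 := lt_of_mul_lt_mul_right (by omega) (Nat.zero_le (K - 1))
    gcongr
    omega
  · ext y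
    rw [hmem, ConjClasses.mem_carrier_iff_mk_eq, ConjClasses.mk_eq_mk_iff_isConj]
    constructor
    · intro h
      exact ((alternatingGroup (Cube K)).subtype.map_isConj h).symm
    · intro h
      -- Conjugacy in the symmetric group descends to the alternating group because the cycle fixes
      -- at least two points.
      refine (alternatingGroup.isConj_of h ?_).symm
      rw [hcard, Fintype.card_fun, ZMod.card, Fintype.card_fin]
      have h1 : ((1 + a * (K - 1) : ℕ) : ℝ) < (K : ℝ) ^ 5 :=
        ha1.trans_le (div_le_self (by positivity) (by linarith))
      have h2 : 1 + a * (K - 1) < K ^ 5 := by exact_mod_cast h1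
      have h3 : K ^ 5 * 2 ≤ K ^ 6 := by
        rw [pow_succ K 5]
        exact Nat.mul_le_mul_left _ (by omega)
      have h4 : 2 ≤ K ^ 5 := by
        have := Nat.le_self_pow (n := 5) (by norm_num) K
        omega
      omega
  · let C : Finset (Equiv.Perm (Cube K)) := Finset.univ.filter fun y => IsConj (c' : Equiv.Perm (Cube K)) y
    let S := C.filter fun y => y ∉ shiftPerms K ^ 47
    have hinj := (alternatingGroup (Cube K)).subtype_injective
    have hC : (cyclesOfLength K (1 + a * (K - 1))).ncard = C.card := by
      rw [← Set.ncard_image_of_injective _ hinj, ← Set.ncard_coe_finset]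
      congr 1
      ext y
      simp only [Set.mem_image, C, Finset.coe_filter, Finset.mem_univ, true_and, Set.mem_ofPred_eq]
      constructor
      · rintro ⟨z, hz, rfl⟩
        exact (hmem z).1 hz
      · intro h
        have hy : y ∈ alternatingGroup (Cube K) := by
          obtain ⟨g, rfl⟩ := isConj_iff.1 h
          rw [Equiv.Perm.mem_alternatingGroup]
          have := Equiv.Perm.mem_alternatingGroup.1 c'.2
          simp [this]
        exact ⟨⟨y, hy⟩, (hmem _).2 h, rfl⟩
    have hS : (cyclesOfLength K (1 + a * (K - 1)) \ lineShifts hK ^ 47).ncard ≤ S.card := by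
      rw [← Set.ncard_image_of_injective _ hinj, ← Set.ncard_coe_finset]
      refine Set.ncard_le_ncard ?_ (Finset.finite_toSet _)
      rintro _ ⟨z, ⟨hz, hzE⟩, rfl⟩
      simp only [S, C, Finset.coe_filter, Finset.mem_filter, Finset.mem_univ, true_and,
        Set.mem_ofPred_eq]
      exact ⟨(hmem z).1 hz, fun h => hzE ((mem_lineShifts_pow_iff hK 47 z).2 h)⟩
    rw [hC]
    refine (Nat.cast_le.2 hS).trans (card_le_of_card_conj_le (c' : Equiv.Perm (Cube K)) S C
      (Finset.filter_subset _ _) (by simp [C]) (1 / 100) ?_)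
    refine le_trans ?_ (card_conj_notMem_le hK6 hc7 h5 hF hn (by rw [hcard]; exact ha1))
    refine Nat.cast_le.2 (Finset.card_le_card fun g hg => ?_)
    rw [Finset.mem_filter] at hg ⊢
    exact ⟨Finset.mem_univ _, (Finset.mem_filter.1 hg.2).2⟩
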